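/- **Theorem 1.3.** Let $k\ge 2$. A finite $k$-uniform hypergraph $\mathcal H=(V,E)$ has a finite vertex set $V$, and its edges are $k$-element subsets of $V$. A path is a sequence $(v_0,e_1,v_1,\dots,e_\ell,v_\ell)$ of distinct vertices and distinct edges with $v_{i-1},v_i\in e_i$ for $1\le i\le \ell$; a cycle is such a sequence with $\ell\ge 2$ in which all vertices and edges are distinct except that $v_0=v_\ell$. A $k$-tree is a finite $k$-uniform hypergraph with $V\neq\emptyset$ that is connected (any two vertices are joined by a path) and has no cycle. Let $p(\mathcal H,r)$ be the number of matchings of $\mathcal H$ with $r$ edges, i.e. sets of $r$ pairwise disjoint edges, with $p(\mathcal H,0)=1$. The matching polynomial is $$\mu(\mathcal H,x)=\sum_{r\ge 0}(-1)^r\,p(\mathcal H,r)\,x^{|V|-kr},$$ and $\lambda(\mathcal H)$ denotes the maximum modulus of the complex zeros of $\mu(\mathcal H,x)$. The adjacency tensor $\mathcal A(\mathcal H)=(a_{i_1\dots i_k})$, with $i_1,\dots,i_k\in V$, has $a_{i_1\dots i_k}=\frac1{(k-1)!}$ if $\{i_1,\dots,i_k\}\in E$ and $a_{i_1\dots i_k}=0$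 otherwise. A number $z\in\mathbb C$ is an eigenvalue of $\mathcal A(\mathcal H)$ if there is a nonzero vector $\mathbf x\in\mathbb C^{V}$ such that $$\sum_{i_2,\dots,i_k\in V}a_{i\,i_2\dots i_k}\,\mathbf x_{i_2}\cdots \mathbf x_{i_k}=z\,\mathbf x_i^{\,k-1}\qquad\text{for all } i\in V,$$ and the spectral radius of $\mathcal A(\mathcal H)$ is the maximum modulus of its eigenvalues. Let $\mathcal T$ be a $k$-tree. Then every complex zero of $\mu(\mathcal T,x)$ is an eigenvalue of $\mathcal A(\mathcal T)$. Moreover, the maxima defining $\lambda(\mathcal T)$ and the spectral radius of $\mathcal A(\mathcal T)$ exist, $\lambda(\mathcal T)$ is a root of $\mu(\mathcal T,x)$, and $\lambda(\mathcal T)$ equals the spectral radius of $\mathcal A(\mathcal T)$. -/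

import Mathlib

namespace Hypergraph

variable {α : Type*}

/-- `H` is `k`-uniform: every edge is a `k`-element set. -/
def IsUniform (H : Hypergraph α) (k : ℕ) : Prop :=
  ∀ e ∈ H.edgeSet, e.ncard = k

/-- The alternating sequence `v₀, e₁, v₁, …, e_ℓ, v_ℓ` (edges indexed from `0` here) is such that
each `e_{i+1}` is an edge containing `v_i` and `v_{i+1}`. -/
def IsWalk (H : Hypergraph α) {l : ℕ} (v : Fin (l + 1) → α) (e : Fin l → Set α) : Prop :=
  ∀ i : Fin l, e i ∈ H.edgeSet ∧ v i.castSucc ∈ e i ∧ v i.succ ∈ e i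

/-- A path: all vertices and all edges of the sequence are distinct. -/
def IsPath (H : Hypergraph α) {l : ℕ} (v : Fin (l + 1) → α) (e : Fin l → Set α) : Prop :=
  H.IsWalk v e ∧ Function.Injective v ∧ Function.Injective e

/-- A cycle: as for a path, except that `v₀ = v_ℓ`. The length `ℓ` is at least `2`; a cycle of
length `2` consists of two distinct edges sharing two distinct vertices. -/
def IsCycle (H : Hypergraph α) {l : ℕ} (v : Fin (l + 1) → α) (e : Fin l → Set α) : Prop :=
  2 ≤ l ∧ H.IsWalk v e ∧ v 0 = v (Fin.last l) ∧
    Function.Injective (fun i : Fin l => v i.castSucc) ∧ Function.Injective e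

/-- `H` has a vertex and any two of its vertices are joined by a path. -/
def IsConnected (H : Hypergraph α) : Prop :=
  H.vertexSet.Nonempty ∧ ∀ u ∈ H.vertexSet, ∀ w ∈ H.vertexSet,
    ∃ (l : ℕ) (v : Fin (l + 1) → α) (e : Fin l → Set α),
      H.IsPath v e ∧ v 0 = u ∧ v (Fin.last l) = w

/-- `H` has no cycle. -/
def IsAcyclic (H : Hypergraph α) : Prop :=
  ∀ (l : ℕ) (v : Fin (l + 1) → α) (e : Fin l → Set α), ¬ H.IsCycle v e

/-- A `k`-tree: a connected acyclic `k`-uniform hypergraph. -/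
structure IsKTree (H : Hypergraph α) (k : ℕ) : Prop where
  uniform : H.IsUniform k
  connected : H.IsConnected
  acyclic : H.IsAcyclic

/-- A matching: a set of edges of which no two distinct ones share a vertex. -/
def IsMatching (H : Hypergraph α) (M : Set (Set α)) : Prop :=
  M ⊆ H.edgeSet ∧ M.Pairwise Disjoint

/-- The number `p(H, r)` of matchings with exactly `r` edges. -/
noncomputable def numMatchings (H : Hypergraph α) (r : ℕ) : ℕ :=
  {M : Set (Set α) | H.IsMatching M ∧ M.ncard = r}.ncard

/-- The matching polynomial `∑_{r ≥ 0} (-1)^r p(H, r) x^(|V| - k r)` of a finite `k`-uniform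
hypergraph. The terms with `r > |E|` vanish, and so do those with `k r > |V|` (the edges of a
matching are disjoint `k`-sets), so the truncated subtraction is never seen. -/
noncomputable def matchingPoly (H : Hypergraph α) (k : ℕ) : Polynomial ℝ :=
  ∑ r ∈ Finset.range (H.edgeSet.ncard + 1),
    Polynomial.C ((-1 : ℝ) ^ r * (H.numMatchings r : ℝ)) *
      Polynomial.X ^ (H.vertexSet.ncard - k * r)

/-- The moduli of the complex zeros of the matching polynomial. -/
def zeroModuli (H : Hypergraph α) (k : ℕ) : Set ℝ :=
  {r : ℝ | ∃ z : ℂ, Polynomial.aeval z (H.matchingPoly k) = 0 ∧ ‖z‖ = r}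

/-- `λ(H)`, the largest modulus of a complex zero of the matching polynomial. -/
noncomputable def maxZeroModulus (H : Hypergraph α) (k : ℕ) : ℝ :=
  sSup (H.zeroModuli k)

end Hypergraph

/-- Real tensors of order `k ≥ 1` with indices in `V`: the entry `a_{i₁ i₂ … i_k}` is `a i₁ j`,
where `j` lists the remaining `k - 1` indices `i₂, …, i_k`. -/
abbrev RealTensor (V : Type*) (k : ℕ) : Type _ := V → (Fin (k - 1) → V) → ℝ

namespace RealTensor

variable {V : Type*} {k : ℕ}

/-- The vector `A x^{k-1}`, whose `i`-th component is
`∑_{i₂, …, i_k} a_{i i₂ … i_k} x_{i₂} ⋯ x_{i_k}`. -/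
noncomputable def apply [Fintype V] (A : RealTensor V k) (x : V → ℂ) : V → ℂ :=
  fun i => ∑ j : Fin (k - 1) → V, (A i j : ℂ) * ∏ l, x (j l)

/-- `z` is an eigenvalue of `A`: the system `A x^{k-1} = z x^{[k-1]}` has a nonzero complex
solution. -/
def IsEigenvalue [Fintype V] (A : RealTensor V k) (z : ℂ) : Prop :=
  ∃ x : V → ℂ, x ≠ 0 ∧ ∀ i, A.apply x i = z * x i ^ (k - 1)

/-- The moduli of the eigenvalues of `A`. -/
def eigenvalueModuli [Fintype V] (A : RealTensor V k) : Set ℝ :=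
  {r : ℝ | ∃ z : ℂ, A.IsEigenvalue z ∧ ‖z‖ = r}

/-- The spectral radius of `A`, the largest modulus of an eigenvalue. -/
noncomputable def spectralRadius [Fintype V] (A : RealTensor V k) : ℝ :=
  sSup A.eigenvalueModuli

end RealTensor

open Classical in
/-- The adjacency tensor of a `k`-uniform hypergraph: the entry at `(i₁, …, i_k)` is `1/(k-1)!` if
`{i₁, …, i_k}` is an edge, and `0` otherwise. -/
noncomputable def Hypergraph.adjacencyTensor {α : Type*} (H : Hypergraph α) (k : ℕ) :
    RealTensor H.vertexSet k :=
  fun i j =>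
    if insert (i : α) (Set.range fun l => (j l : α)) ∈ H.edgeSet then
      1 / ((k - 1).factorial : ℝ)
    else 0

/-!
Everything is done for a finite family `E` of `k`-element sets with a separate weight `a v` at each
vertex. The weighted matching polynomial `matchingSum E a` sums, over the matchings of `E`, the
signed product of the weights of the uncovered vertices; the weighted eigenvalue system is
`∑_{e ∋ v} ∏_{w ∈ e, w ≠ v} x_w = a_v x_v ^ (k - 1)` for all `v`. Constant weights give the matching
polynomial (`IsUniform.aeval_matchingPoly`) and the eigenvalue problem of the adjacency tensor
(`IsUniform.adjacencyTensor_apply`).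

An acyclic family has a pendant edge `e`, all of whose vertices but one, `v`, lie in no other edge
(`IsAcyclic.isForest`). If the weights `a_u` of these vertices are nonzero, eliminating their
variables removes `e` and replaces `a_v` by `a_v - ∏_u a_u⁻¹`. The same substitution removes `e` from
the weighted matching polynomial, up to the factor `∏_u a_u` (`IsPendant.matchingSum_reduce`). So the
two problems are reduced in parallel, and induction on the number of edges gives:

* every zero of the matching polynomial has an eigenvector (`IsForest.exists_isEigenvector`), where
  a vanishing weight `a_u` needs a separate argument: for `k ≥ 3` the indicator of `u` is an
  eigenvector, and for `k = 2` both ends of `e` can be deleted;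
* conversely, weights with a nowhere vanishing eigenvector are a zero
  (`IsForest.matchingSum_eq_zero`);
* a tree has a positive eigenvector for some real eigenvalue `l`
  (`IsForest.exists_pos_eigenvector`): carrying the weights along as functions of a real parameter,
  one is left with a single vertex, whose weight vanishes somewhere by the intermediate value
  theorem.

By the second point `l` is a zero of the matching polynomial. A positive eigenvector bounds the
modulus of every eigenvalue by `l` (`norm_le_of_pos_eigenvector`), hence by the first point also that
of every zero, and `l` is both maxima.
-/

namespace Hypergraph

/-! ### Multivariate matching polynomials and pendant edges -/

/-- Vertex `v` and edge `e` of the finite edge family `E` such that every vertex of `e` other than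
`v` lies in no further edge. -/
structure IsPendant {V : Type*} (E : Finset (Finset V)) (e : Finset V) (v : V) : Prop where
  mem : e ∈ E
  vertex_mem : v ∈ e
  eq_of_mem : ∀ u ∈ e, u ≠ v → ∀ f ∈ E, u ∈ f → f = e

/-- A finite edge family all of whose nonempty subfamilies have a pendant edge. For uniform
families this is acyclicity, in the form in which it is used for induction on the edges. -/
def IsForest {V : Type*} (E : Finset (Finset V)) : Prop :=
  ∀ F ⊆ E, F.Nonempty → ∃ e v, IsPendant F e v

lemma IsForest.mono {V : Type*} {E F : Finset (Finset V)} (hE : IsForest E) (h : F ⊆ E) :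
    IsForest F :=
  fun G hG => hE G (hG.trans h)

open Classical in
/-- The matchings in a finite edge family. -/
noncomputable def matchings {V : Type*} (E : Finset (Finset V)) : Finset (Finset (Finset V)) :=
  E.powerset.filter fun N => (N : Set (Finset V)).PairwiseDisjoint id

lemma mem_matchings {V : Type*} {E N : Finset (Finset V)} :
    N ∈ matchings E ↔ N ⊆ E ∧ (N : Set (Finset V)).PairwiseDisjoint id := by
  simp only [matchings, Finset.mem_filter, Finset.mem_powerset]

section

variable {V : Type*} [DecidableEq V]

/-- The sum `∑_{e ∋ v} ∏_{w ∈ e, w ≠ v} x_w`, which is the `v`-th component of the adjacency tensor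
applied to `x`. -/
def edgeSum {R : Type*} [CommSemiring R] (E : Finset (Finset V)) (x : V → R) (v : V) : R :=
  ∑ e ∈ E with v ∈ e, ∏ w ∈ e.erase v, x w

/-- `x` solves the eigenvalue system with a separate eigenvalue `a v` at each vertex `v`. -/
def IsEigenvector {R : Type*} [CommSemiring R] (E : Finset (Finset V)) (k : ℕ) (a x : V → R) :
    Prop :=
  ∀ v, edgeSum E x v = a v * x v ^ (k - 1)

/-- The weights after a pendant edge `e` attached at `v` has been removed: weight `1` at the
other vertices of `e`, and `a_v - ∏_u a_u⁻¹` at `v`. -/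
def reduceWeight {K : Type*} [Field K] (a : V → K) (e : Finset V) (v : V) (w : V) : K :=
  if w = v then a v - ∏ u ∈ e.erase v, (a u)⁻¹ else if w ∈ e then 1 else a w

/-- The signed product of the weights of the vertices that `N` leaves uncovered. -/
def matchingTerm {R : Type*} [CommRing R] [Fintype V] (a : V → R) (N : Finset (Finset V)) : R :=
  (-1) ^ N.card * ∏ w, if ∃ f ∈ N, w ∈ f then 1 else a w

/-- The matching polynomial with an independent variable `a v` for each vertex `v`. -/
noncomputable def matchingSum {R : Type*} [CommRing R] [Fintype V] (E : Finset (Finset V))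
    (a : V → R) : R :=
  ∑ N ∈ matchings E, matchingTerm a N

section edgeSum

variable {R : Type*} [CommSemiring R] {E : Finset (Finset V)} {e : Finset V} {v : V}

lemma edgeSum_congr {x y : V → R} {w : V}
    (h : ∀ f ∈ E, w ∈ f → ∀ u ∈ f, u ≠ w → x u = y u) : edgeSum E x w = edgeSum E y w := by
  refine Finset.sum_congr rfl fun f hf => Finset.prod_congr rfl fun u hu => ?_
  rw [Finset.mem_filter] at hf
  rw [Finset.mem_erase] at hu
  exact h f hf.1 hf.2 u hu.2 hu.1

lemma edgeSum_eq_zero_of_forall_notMem {x : V → R} {w : V} (h : ∀ f ∈ E, w ∉ f) :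
    edgeSum E x w = 0 := by
  rw [edgeSum, Finset.filter_false_of_mem h, Finset.sum_empty]

lemma edgeSum_eq_add_erase {x : V → R} {w : V} (he : e ∈ E) (hw : w ∈ e) :
    edgeSum E x w = ∏ u ∈ e.erase w, x u + edgeSum (E.erase e) x w := by
  rw [edgeSum, edgeSum, Finset.filter_erase,
    Finset.add_sum_erase _ (fun f => ∏ u ∈ f.erase w, x u) (Finset.mem_filter.2 ⟨he, hw⟩)]

lemma edgeSum_erase_of_notMem {x : V → R} {w : V} (hw : w ∉ e) :
    edgeSum (E.erase e) x w = edgeSum E x w := by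
  rw [edgeSum, edgeSum, Finset.filter_erase, Finset.erase_eq_of_notMem]
  simp [hw]

lemma IsPendant.notMem_of_mem_erase (h : IsPendant E e v) {u : V} (hu : u ∈ e.erase v)
    {f : Finset V} (hf : f ∈ E.erase e) : u ∉ f := fun huf =>
  Finset.ne_of_mem_erase hf (h.eq_of_mem u (Finset.mem_of_mem_erase hu) (Finset.ne_of_mem_erase hu)
    f (Finset.mem_of_mem_erase hf) huf)

lemma IsPendant.edgeSum_of_mem_erase (h : IsPendant E e v) (x : V → R) {u : V}
    (hu : u ∈ e.erase v) : edgeSum E x u = x v * ∏ w ∈ (e.erase v).erase u, x w := by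
  rw [edgeSum_eq_add_erase h.mem (Finset.mem_of_mem_erase hu),
    edgeSum_eq_zero_of_forall_notMem fun f hf => h.notMem_of_mem_erase hu hf, add_zero,
    Finset.erase_right_comm, Finset.mul_prod_erase]
  exact Finset.mem_erase.2 ⟨(Finset.ne_of_mem_erase hu).symm, h.vertex_mem⟩

end edgeSum

section eigenvector

variable {K : Type*} [Field K] {E : Finset (Finset V)} {e : Finset V} {v : V} {k : ℕ}

/-- A solution for the reduced weights extends over a pendant edge, given values `y` at its
vertices that satisfy the two local equations. -/
lemma IsPendant.isEigenvector_extend (h : IsPendant E e v) {a x y : V → K}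
    (hx : IsEigenvector (E.erase e) k (reduceWeight a e v) x)
    (hy : ∀ u ∈ e.erase v, x v * ∏ w ∈ (e.erase v).erase u, y w = a u * y u ^ (k - 1))
    (hp : ∏ u ∈ e.erase v, y u = x v ^ (k - 1) * ∏ u ∈ e.erase v, (a u)⁻¹) :
    IsEigenvector E k a (fun w => if w ∈ e.erase v then y w else x w) := by
  have hcong : ∀ w, edgeSum (E.erase e) (fun w => if w ∈ e.erase v then y w else x w) w
      = edgeSum (E.erase e) x w := fun w =>
    edgeSum_congr fun f hf _ u huf _ =>
      if_neg fun hu => h.notMem_of_mem_erase hu hf huf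
  intro w
  beta_reduce
  by_cases hw : w ∈ e.erase v
  · rw [h.edgeSum_of_mem_erase _ hw, if_pos hw, if_neg (Finset.notMem_erase v e), ← hy w hw]
    congr 1
    exact Finset.prod_congr rfl fun u hu => if_pos (Finset.mem_of_mem_erase hu)
  · rw [if_neg hw]
    by_cases hwv : w = v
    · subst hwv
      have := hx w
      rw [edgeSum_eq_add_erase h.mem h.vertex_mem, hcong, this, reduceWeight, if_pos rfl,
        Finset.prod_congr rfl fun u hu => if_pos hu, hp]
      ring
    · have hwe : w ∉ e := fun hwe => hw (Finset.mem_erase.2 ⟨hwv, hwe⟩)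
      rw [← edgeSum_erase_of_notMem hwe, hcong, hx w, reduceWeight, if_neg hwv, if_neg hwe]

/-- If no coordinate vanishes on the pendant edge, the edge's variables can be eliminated. -/
lemma IsPendant.isEigenvector_reduce (h : IsPendant E e v) (hk : 1 ≤ k) (hcard : e.card = k)
    {a x : V → K} (hx : IsEigenvector E k a x) (hne : ∀ u ∈ e, x u ≠ 0) :
    (∀ u ∈ e.erase v, a u ≠ 0) ∧
      IsEigenvector (E.erase e) k (reduceWeight a e v)
        (fun w => if w ∈ e.erase v then 0 else x w) := by
  obtain ⟨k, rfl⟩ := Nat.exists_eq_add_of_le' hk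
  have hcardU : (e.erase v).card = k := by
    rw [Finset.card_erase_of_mem h.vertex_mem, hcard, Nat.add_sub_cancel]
  have hU : ∀ u ∈ e.erase v, a u * x u ^ (k + 1) = x v * ∏ w ∈ e.erase v, x w := by
    intro u hu
    have h1 := hx u
    rw [h.edgeSum_of_mem_erase _ hu] at h1
    rw [← Finset.prod_erase_mul _ _ hu, ← mul_assoc, h1, Nat.add_sub_cancel, pow_succ, mul_assoc]
  have hPne : ∏ w ∈ e.erase v, x w ≠ 0 :=
    Finset.prod_ne_zero_iff.2 fun u hu => hne u (Finset.mem_of_mem_erase hu)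
  have hv := hne v h.vertex_mem
  have ha : ∀ u ∈ e.erase v, a u ≠ 0 := by
    intro u hu h0
    have := hU u hu
    rw [h0, zero_mul] at this
    exact mul_ne_zero hv hPne this.symm
  have hP : (∏ u ∈ e.erase v, a u) * ∏ w ∈ e.erase v, x w = x v ^ k := by
    have h1 := Finset.prod_congr rfl hU
    rw [Finset.prod_mul_distrib, Finset.prod_const, hcardU, Finset.prod_pow, mul_pow,
      pow_succ' (∏ w ∈ e.erase v, x w), ← mul_assoc] at h1
    exact mul_right_cancel₀ (pow_ne_zero k hPne) h1
  refine ⟨ha, fun w => ?_⟩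
  have hcong : ∀ w, edgeSum (E.erase e) (fun w => if w ∈ e.erase v then 0 else x w) w
      = edgeSum (E.erase e) x w := fun w =>
    edgeSum_congr fun f hf _ u huf _ =>
      if_neg fun hu => h.notMem_of_mem_erase hu hf huf
  have hdiv : ∏ w ∈ e.erase v, x w = x v ^ k * ∏ u ∈ e.erase v, (a u)⁻¹ := by
    rw [← hP, Finset.prod_inv_distrib]
    have : ∏ u ∈ e.erase v, a u ≠ 0 := Finset.prod_ne_zero_iff.2 ha
    field_simp
  beta_reduce
  by_cases hw : w ∈ e.erase v
  · rw [edgeSum_eq_zero_of_forall_notMem fun f hf => h.notMem_of_mem_erase hw hf, if_pos hw]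
    have hk0 : k ≠ 0 := by
      rw [← hcardU]; exact Finset.card_ne_zero_of_mem hw
    rw [Nat.add_sub_cancel, zero_pow hk0, mul_zero]
  · rw [if_neg hw, hcong]
    by_cases hwv : w = v
    · subst hwv
      have h1 := hx w
      rw [edgeSum_eq_add_erase h.mem h.vertex_mem, hdiv] at h1
      rw [reduceWeight, if_pos rfl, sub_mul, ← h1, Nat.add_sub_cancel]
      ring
    · have hwe : w ∉ e := fun hwe => hw (Finset.mem_erase.2 ⟨hwv, hwe⟩)
      rw [edgeSum_erase_of_notMem hwe, hx w, reduceWeight, if_neg hwv, if_neg hwe]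

end eigenvector

section matchingSum

variable [Fintype V] {E : Finset (Finset V)} {e : Finset V} {v : V}

lemma matchingSum_empty {R : Type*} [CommRing R] (a : V → R) : matchingSum ∅ a = ∏ w, a w := by
  have h : matchings (∅ : Finset (Finset V)) = {∅} := by
    ext N
    rw [mem_matchings, Finset.subset_empty, Finset.mem_singleton, and_iff_left_iff_imp]
    rintro rfl
    simp
  rw [matchingSum, h, Finset.sum_singleton]
  simp [matchingTerm]

lemma matchingTerm_insert {R : Type*} [CommRing R] {N : Finset (Finset V)} (he : e ∉ N)
    (a : V → R) :
    matchingTerm a (insert e N) = -matchingTerm (fun w => if w ∈ e then 1 else a w) N := by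
  rw [matchingTerm, matchingTerm, Finset.card_insert_of_notMem he, pow_succ, mul_neg_one, neg_mul]
  congr 2
  refine Finset.prod_congr rfl fun w _ => ?_
  by_cases h1 : w ∈ e <;> by_cases h2 : ∃ f ∈ N, w ∈ f <;> simp [h1, h2]

/-- The matchings that contain a pendant edge `e` attached at `v` are the matchings of the other
edges that leave `v` uncovered, with `e` added. -/
lemma IsPendant.matchingSum_eq {R : Type*} [CommRing R] (h : IsPendant E e v) (a : V → R) :
    matchingSum E a = ∑ N ∈ matchings (E.erase e), (matchingTerm a N +
      if ∃ f ∈ N, v ∈ f then 0 else -matchingTerm (fun w => if w ∈ e then 1 else a w) N) := by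
  rw [matchingSum, matchings, Finset.sum_filter]
  nth_rewrite 1 [← Finset.insert_erase h.mem]
  rw [Finset.sum_powerset_insert (Finset.notMem_erase e E), ← Finset.sum_add_distrib, matchings,
    Finset.sum_filter]
  refine Finset.sum_congr rfl fun N hN => ?_
  rw [Finset.mem_powerset] at hN
  have heN : e ∉ N := fun he => Finset.notMem_erase e E (hN he)
  have hiff : ((insert e N : Finset (Finset V)) : Set (Finset V)).PairwiseDisjoint id ↔
      (N : Set (Finset V)).PairwiseDisjoint id ∧ ¬ ∃ f ∈ N, v ∈ f := by
    rw [Finset.coe_insert, Set.pairwiseDisjoint_insert_of_notMem (by simpa using heN)]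
    refine and_congr_right fun _ => ?_
    push Not
    refine forall₂_congr fun f hf => ?_
    rw [id, id, Finset.disjoint_left]
    refine ⟨fun hd => hd h.vertex_mem, fun hv u hu huf => ?_⟩
    by_cases huv : u = v
    · exact hv (huv ▸ huf)
    · exact h.notMem_of_mem_erase (Finset.mem_erase.2 ⟨huv, hu⟩) (hN hf) huf
  rw [matchingTerm_insert heN]
  by_cases h1 : (N : Set (Finset V)).PairwiseDisjoint id <;>
    by_cases h2 : ∃ f ∈ N, v ∈ f <;> simp only [hiff, h1, h2] <;> simp

lemma prod_univ_eq_of_mem {R : Type*} [CommRing R] (hv : v ∈ e) (g : V → R) :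
    ∏ w, g w = g v * (∏ u ∈ e.erase v, g u) * ∏ w ∈ eᶜ, g w := by
  rw [Finset.mul_prod_erase _ _ hv, Finset.prod_mul_prod_compl]

/-- Removal of a pendant edge from the multivariate matching polynomial. -/
lemma IsPendant.matchingSum_reduce {K : Type*} [Field K] (h : IsPendant E e v) {a : V → K}
    (ha : ∀ u ∈ e.erase v, a u ≠ 0) :
    matchingSum E a =
      (∏ u ∈ e.erase v, a u) * matchingSum (E.erase e) (reduceWeight a e v) := by
  rw [h.matchingSum_eq, matchingSum, Finset.mul_sum]
  refine Finset.sum_congr rfl fun N hN => ?_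
  rw [mem_matchings] at hN
  have hunc : ∀ u ∈ e.erase v, ¬ ∃ f ∈ N, u ∈ f := by
    rintro u hu ⟨f, hf, huf⟩
    exact h.notMem_of_mem_erase hu (hN.1 hf) huf
  have hmem : ∀ u ∈ e.erase v, u ∈ e := fun u hu => Finset.mem_of_mem_erase hu
  simp only [matchingTerm]
  rw [prod_univ_eq_of_mem h.vertex_mem, prod_univ_eq_of_mem h.vertex_mem (fun w =>
      if ∃ f ∈ N, w ∈ f then 1 else if w ∈ e then 1 else a w),
    prod_univ_eq_of_mem h.vertex_mem (fun w =>
      if ∃ f ∈ N, w ∈ f then 1 else reduceWeight a e v w)]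
  have hU1 : ∏ u ∈ e.erase v, (if ∃ f ∈ N, u ∈ f then 1 else a u) = ∏ u ∈ e.erase v, a u :=
    Finset.prod_congr rfl fun u hu => if_neg (hunc u hu)
  have hU2 : ∏ u ∈ e.erase v, (if ∃ f ∈ N, u ∈ f then 1 else if u ∈ e then 1 else a u) = 1 :=
    Finset.prod_eq_one fun u hu => by rw [if_neg (hunc u hu), if_pos (hmem u hu)]
  have hU3 : ∏ u ∈ e.erase v, (if ∃ f ∈ N, u ∈ f then 1 else reduceWeight a e v u) = 1 :=
    Finset.prod_eq_one fun u hu => by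
      rw [if_neg (hunc u hu), reduceWeight, if_neg (Finset.ne_of_mem_erase hu), if_pos (hmem u hu)]
  have hC2 : ∏ w ∈ eᶜ, (if ∃ f ∈ N, w ∈ f then 1 else if w ∈ e then 1 else a w)
      = ∏ w ∈ eᶜ, (if ∃ f ∈ N, w ∈ f then 1 else a w) :=
    Finset.prod_congr rfl fun w hw => by rw [if_neg (Finset.mem_compl.1 hw)]
  have hC3 : ∏ w ∈ eᶜ, (if ∃ f ∈ N, w ∈ f then 1 else reduceWeight a e v w)
      = ∏ w ∈ eᶜ, (if ∃ f ∈ N, w ∈ f then 1 else a w) :=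
    Finset.prod_congr rfl fun w hw => by
      have hwe := Finset.mem_compl.1 hw
      have hwv : w ≠ v := fun hwv => hwe (hwv ▸ h.vertex_mem)
      rw [reduceWeight, if_neg hwv, if_neg hwe]
  rw [hU1, hU2, hU3, hC2, hC3, if_pos h.vertex_mem, reduceWeight, if_pos rfl,
    Finset.prod_inv_distrib]
  have hne : ∏ u ∈ e.erase v, a u ≠ 0 := Finset.prod_ne_zero_iff.2 ha
  by_cases hv : ∃ f ∈ N, v ∈ f
  · simp only [if_pos hv]
    ring
  · simp only [if_neg hv]
    field_simp
    ring

/-- If some vertex of a pendant edge `e` other than its point of attachment `v` has weight zero,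
only the matchings containing `e` contribute. -/
lemma IsPendant.matchingSum_of_eq_zero {R : Type*} [CommRing R] (h : IsPendant E e v) {a : V → R}
    {u : V} (hu : u ∈ e.erase v) (ha : a u = 0) :
    matchingSum E a =
      -matchingSum (E.filter fun f => v ∉ f) (fun w => if w ∈ e then 1 else a w) := by
  rw [h.matchingSum_eq, matchingSum, ← Finset.sum_neg_distrib]
  have hsub : matchings (E.filter fun f => v ∉ f) =
      (matchings (E.erase e)).filter fun N => ¬ ∃ f ∈ N, v ∈ f := by
    ext N
    simp only [mem_matchings, Finset.mem_filter]
    constructor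
    · rintro ⟨h1, h2⟩
      refine ⟨⟨fun f hf => ?_, h2⟩, ?_⟩
      · have := Finset.mem_filter.1 (h1 hf)
        exact Finset.mem_erase.2 ⟨fun hfe => this.2 (hfe ▸ h.vertex_mem), this.1⟩
      · rintro ⟨f, hf, hv⟩
        exact (Finset.mem_filter.1 (h1 hf)).2 hv
    · rintro ⟨⟨h1, h2⟩, h3⟩
      exact ⟨fun f hf => Finset.mem_filter.2
        ⟨Finset.mem_of_mem_erase (h1 hf), fun hv => h3 ⟨f, hf, hv⟩⟩, h2⟩
  rw [hsub, Finset.sum_filter]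
  refine Finset.sum_congr rfl fun N hN => ?_
  have h0 : matchingTerm a N = 0 := by
    rw [matchingTerm, Finset.prod_eq_zero (Finset.mem_univ u), mul_zero]
    rw [if_neg, ha]
    rintro ⟨f, hf, huf⟩
    exact h.notMem_of_mem_erase hu ((mem_matchings.1 hN).1 hf) huf
  rw [h0, zero_add]
  by_cases hv : ∃ f ∈ N, v ∈ f <;> simp only [hv] <;> simp

end matchingSum

end

/-! ### Eigenvectors from zeros, zeros from eigenvectors, and a bound -/

/-- The value of a product is determined up to a `k`-th root of unity by `k`-th powers of its
factors. -/
lemma prod_pow_eq_of_pow_eq {V K : Type*} [Field K] {k : ℕ} {U : Finset V} {a y : V → K} {c : K}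
    (hk : 1 ≤ k) (hU : U.card = k - 1)
    (hy : ∀ u ∈ U, y u ^ k = c ^ k * (∏ w ∈ U, (a w)⁻¹) * (a u)⁻¹) :
    (∏ u ∈ U, y u) ^ k = (c ^ (k - 1) * ∏ w ∈ U, (a w)⁻¹) ^ k := by
  rw [← Finset.prod_pow, Finset.prod_congr rfl hy, Finset.prod_mul_distrib, Finset.prod_const, hU]
  obtain ⟨m, rfl⟩ := Nat.exists_eq_add_of_le' hk
  rw [Nat.add_sub_cancel, mul_pow, mul_pow, pow_succ (∏ w ∈ U, (a w)⁻¹), ← pow_mul, ← pow_mul,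
    mul_comm m]
  ring

section

variable {V : Type*} [DecidableEq V]

section roots

variable {K : Type*} [Field K] {k : ℕ} {U : Finset V} {a y : V → K} {c : K}

/-- The equation at a vertex of a pendant edge, from the `k`-th power of its coordinate and the
product of all the coordinates. -/
lemma mul_prod_erase_eq_of_pow_eq (hk : 1 ≤ k) (hc : c ≠ 0) (ha : ∀ u ∈ U, a u ≠ 0)
    (hy : ∀ u ∈ U, a u * y u ^ k = c ^ k * ∏ w ∈ U, (a w)⁻¹)
    (hp : ∏ u ∈ U, y u = c ^ (k - 1) * ∏ u ∈ U, (a u)⁻¹) {u : V} (hu : u ∈ U) :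
    c * ∏ w ∈ U.erase u, y w = a u * y u ^ (k - 1) := by
  obtain ⟨k, rfl⟩ := Nat.exists_eq_add_of_le' hk
  rw [Nat.add_sub_cancel] at *
  have hP : ∏ w ∈ U, (a w)⁻¹ ≠ 0 := Finset.prod_ne_zero_iff.2 fun w hw => inv_ne_zero (ha w hw)
  have h1 := hy u hu
  have hyu : y u ≠ 0 := by
    intro h0
    rw [h0, zero_pow (Nat.succ_ne_zero k), mul_zero] at h1
    exact mul_ne_zero (pow_ne_zero _ hc) hP h1.symm
  refine mul_right_cancel₀ hyu ?_
  rw [mul_assoc, Finset.prod_erase_mul _ _ hu, hp, mul_assoc (a u), ← pow_succ, h1, pow_succ]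
  ring

end roots

/-- The values of an eigenvector on a pendant edge, given the value `c` at the point of
attachment. The local equations determine `k`-th powers; the product of the chosen `k`-th roots
is then correct up to a `k`-th root of unity, which one of the factors absorbs. -/
lemma exists_complex_extension {k : ℕ} (hk : 2 ≤ k) {U : Finset V} (hU : U.card = k - 1)
    {a : V → ℂ} {c : ℂ} (ha : ∀ u ∈ U, a u ≠ 0) :
    ∃ y : V → ℂ, (∀ u ∈ U, c * ∏ w ∈ U.erase u, y w = a u * y u ^ (k - 1)) ∧
      ∏ u ∈ U, y u = c ^ (k - 1) * ∏ u ∈ U, (a u)⁻¹ := by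
  have hk0 : 0 < k := by omega
  obtain ⟨u₀, hu₀⟩ : U.Nonempty := Finset.card_pos.1 (by omega)
  -- for `c = 0` all values are zero
  by_cases hc : c = 0
  · refine ⟨fun _ => 0, fun u _ => ?_, ?_⟩
    · rw [hc, zero_mul, zero_pow (by omega), mul_zero]
    · rw [hc, zero_pow (by omega), zero_mul, Finset.prod_eq_zero hu₀ rfl]
  set P := ∏ u ∈ U, (a u)⁻¹ with hP
  have hP0 : P ≠ 0 := Finset.prod_ne_zero_iff.2 fun w hw => inv_ne_zero (ha w hw)
  choose r hr using fun u => IsAlgClosed.exists_pow_nat_eq (c ^ k * P * (a u)⁻¹) hk0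
  have hQk : (∏ u ∈ U, r u) ^ k = (c ^ (k - 1) * P) ^ k :=
    prod_pow_eq_of_pow_eq hk0 hU fun u _ => hr u
  have hQ0 : ∏ u ∈ U, r u ≠ 0 := by
    intro h0
    rw [h0, zero_pow hk0.ne'] at hQk
    exact pow_ne_zero k (mul_ne_zero (pow_ne_zero _ hc) hP0) hQk.symm
  set ω := c ^ (k - 1) * P / ∏ u ∈ U, r u with hω
  have hωk : ω ^ k = 1 := by
    rw [hω, div_pow, hQk, div_self]
    exact pow_ne_zero k (mul_ne_zero (pow_ne_zero _ hc) hP0)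
  have hp : ∏ u ∈ U, (if u = u₀ then ω else 1) * r u = c ^ (k - 1) * P := by
    rw [Finset.prod_mul_distrib, Finset.prod_ite_eq' U u₀ (fun _ => ω), if_pos hu₀, hω,
      div_mul_cancel₀ _ hQ0]
  refine ⟨fun u => (if u = u₀ then ω else 1) * r u, fun u hu => ?_, hp⟩
  refine mul_prod_erase_eq_of_pow_eq (by omega) hc ha (fun w hw => ?_) hp hu
  have h1 : (if w = u₀ then ω else 1) ^ k = 1 := by
    split_ifs
    · exact hωk
    · exact one_pow k
  have := ha w hw
  rw [mul_pow, h1, one_mul, hr, ← hP]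
  field_simp

/-- For `k ≥ 3` a vertex of weight zero carries an eigenvector supported on that vertex alone. -/
lemma isEigenvector_single {R : Type*} [CommRing R] {k : ℕ} (hk : 3 ≤ k) {E : Finset (Finset V)}
    (hE : ∀ f ∈ E, f.card = k) {a : V → R} {u : V} (ha : a u = 0) :
    IsEigenvector E k a (Pi.single u 1) := by
  intro w
  have h0 : edgeSum E (Pi.single u (1 : R)) w = 0 := by
    refine Finset.sum_eq_zero fun f hf => ?_
    rw [Finset.mem_filter] at hf
    have hcard : 1 < (f.erase w).card := by
      rw [Finset.card_erase_of_mem hf.2, hE f hf.1]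
      omega
    obtain ⟨t, ht, htu⟩ := Finset.exists_mem_ne hcard u
    exact Finset.prod_eq_zero ht (Pi.single_eq_of_ne htu 1)
  rw [h0]
  by_cases hwu : w = u
  · rw [hwu, ha, zero_mul]
  · rw [Pi.single_eq_of_ne hwu, zero_pow (by omega), mul_zero]

/-- For graphs, a solution that avoids both ends of a pendant edge `e` at `v` extends to `e`
when the pendant vertex `u` has weight zero: the value at `v` is zero, and the value at `u` is
determined by the equation at `v`. -/
lemma IsPendant.exists_isEigenvector_of_eq_zero {K : Type*} [Field K] {E : Finset (Finset V)}
    (hE : ∀ f ∈ E, f.card = 2) {e : Finset V} {u v : V} (h : IsPendant E e v)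
    (hu : u ∈ e.erase v) {a x : V → K} (ha : a u = 0) (hx0 : x ≠ 0)
    (hx : IsEigenvector (E.filter fun f => v ∉ f) 2 (fun w => if w ∈ e then 1 else a w) x) :
    ∃ y : V → K, y ≠ 0 ∧ IsEigenvector E 2 a y := by
  have hue := Finset.mem_of_mem_erase hu
  have huv := Finset.ne_of_mem_erase hu
  have hsingle : e.erase v = {u} := by
    have : (e.erase v).card = 1 := by rw [Finset.card_erase_of_mem h.vertex_mem, hE e h.mem]
    obtain ⟨t, ht⟩ := Finset.card_eq_one.1 this
    rw [ht, Finset.mem_singleton] at hu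
    rw [ht, hu]
  have hxe : ∀ w ∈ e, x w = 0 := by
    intro w hw
    have h1 := hx w
    rw [edgeSum_eq_zero_of_forall_notMem] at h1
    · simpa [hw] using h1.symm
    · intro f hf hwf
      rw [Finset.mem_filter] at hf
      by_cases hwv : w = v
      · exact hf.2 (hwv ▸ hwf)
      · exact hf.2 (h.eq_of_mem w hw hwv f hf.1 hwf ▸ h.vertex_mem)
  set y : V → K := Function.update x u (-edgeSum (E.erase e) x v) with hy
  have hyne : ∀ w, w ≠ u → y w = x w := fun w hw => Function.update_of_ne hw _ _
  have hyv : y v = 0 := by rw [hyne v huv.symm, hxe v h.vertex_mem]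
  have hcong : ∀ w, edgeSum (E.erase e) y w = edgeSum (E.erase e) x w := fun w =>
    edgeSum_congr fun f hf _ t htf _ => hyne t fun htu => h.notMem_of_mem_erase hu hf (htu ▸ htf)
  refine ⟨y, fun h0 => hx0 (funext fun w => ?_), fun w => ?_⟩
  · by_cases hwu : w = u
    · rw [hwu, hxe u hue, Pi.zero_apply]
    · rw [← hyne w hwu, h0]
  · by_cases hwu : w = u
    · rw [hwu, h.edgeSum_of_mem_erase y hu, hyv, ha, zero_mul, zero_mul]
    by_cases hwv : w = v
    · rw [hwv, edgeSum_eq_add_erase h.mem h.vertex_mem, hcong, hsingle, Finset.prod_singleton,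
        hyv, hy, Function.update_self]
      simp
    have hwe : w ∉ e := fun hwe => by
      have : w ∈ e.erase v := Finset.mem_erase.2 ⟨hwv, hwe⟩
      rw [hsingle, Finset.mem_singleton] at this
      exact hwu this
    have h1 : edgeSum E x w = edgeSum (E.filter fun f => v ∉ f) x w := by
      refine (Finset.sum_subset ?_ fun f hf hf' => ?_).symm
      · exact Finset.filter_subset_filter _ (Finset.filter_subset _ _)
      · simp only [Finset.mem_filter, not_and] at hf hf'
        have hvf : v ∈ f := by
          by_contra hvf
          exact hf' ⟨hf.1, hvf⟩ hf.2
        exact Finset.prod_eq_zero (Finset.mem_erase.2 ⟨Ne.symm hwv, hvf⟩) (hxe v h.vertex_mem)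
    rw [← edgeSum_erase_of_notMem hwe, hcong, edgeSum_erase_of_notMem hwe, h1, hx w, hyne w hwu]
    beta_reduce
    rw [if_neg hwe]

variable [Fintype V] {k : ℕ}

/-- Every zero of the multivariate matching polynomial of a forest has an eigenvector. -/
theorem IsForest.exists_isEigenvector (hk : 2 ≤ k) {E : Finset (Finset V)} (hF : IsForest E)
    (hE : ∀ f ∈ E, f.card = k) {a : V → ℂ} (ha : matchingSum E a = 0) :
    ∃ x : V → ℂ, x ≠ 0 ∧ IsEigenvector E k a x := by
  induction E using Finset.strongInduction generalizing a with
  | H E ih =>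
    rcases E.eq_empty_or_nonempty with rfl | hne
    · rw [matchingSum_empty, Finset.prod_eq_zero_iff] at ha
      obtain ⟨u, -, hu⟩ := ha
      refine ⟨Pi.single u 1, by simp, fun w => ?_⟩
      rw [edgeSum_eq_zero_of_forall_notMem fun f hf => absurd hf (Finset.notMem_empty f)]
      by_cases hwu : w = u
      · rw [hwu, hu, zero_mul]
      · rw [Pi.single_eq_of_ne hwu, zero_pow (by omega), mul_zero]
    · obtain ⟨e, v, h⟩ := hF E subset_rfl hne
      by_cases hz : ∃ u ∈ e.erase v, a u = 0
      · obtain ⟨u, hu, hau⟩ := hz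
        rcases hk.eq_or_lt with rfl | hk3
        · have hss : E.filter (fun f => v ∉ f) ⊂ E :=
            Finset.filter_ssubset.2 ⟨e, h.mem, not_not.2 h.vertex_mem⟩
          rw [h.matchingSum_of_eq_zero hu hau, neg_eq_zero] at ha
          obtain ⟨x, hx0, hx⟩ := ih _ hss (hF.mono hss.1) (fun f hf => hE f (hss.1 hf)) ha
          exact h.exists_isEigenvector_of_eq_zero hE hu hau hx0 hx
        · exact ⟨Pi.single u 1, by simp, isEigenvector_single hk3 hE hau⟩
      · push Not at hz
        have hss : E.erase e ⊂ E := Finset.erase_ssubset h.mem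
        rw [h.matchingSum_reduce hz, mul_eq_zero] at ha
        obtain ⟨x, hx0, hx⟩ := ih _ hss (hF.mono hss.1) (fun f hf => hE f (hss.1 hf))
          (ha.resolve_left (Finset.prod_ne_zero_iff.2 hz))
        have hU : (e.erase v).card = k - 1 := by
          rw [Finset.card_erase_of_mem h.vertex_mem, hE e h.mem]
        obtain ⟨y, hy1, hy2⟩ := exists_complex_extension hk hU (c := x v) hz
        refine ⟨_, fun h0 => hx0 (funext fun w => ?_), h.isEigenvector_extend hx hy1 hy2⟩
        by_cases hw : w ∈ e.erase v
        · -- the removed vertices are isolated with weight `1`, which forces `x w = 0`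
          have h1 := hx w
          rw [edgeSum_eq_zero_of_forall_notMem fun f hf => h.notMem_of_mem_erase hw hf,
            reduceWeight, if_neg (Finset.ne_of_mem_erase hw),
            if_pos (Finset.mem_of_mem_erase hw), one_mul] at h1
          exact pow_eq_zero_iff (by omega) |>.1 h1.symm
        · simpa [hw] using congrFun h0 w

/-- Weights that admit an eigenvector with no zero coordinate on the edges of a forest form a zero
of the multivariate matching polynomial. -/
theorem IsForest.matchingSum_eq_zero {K : Type*} [Field K] (hk : 1 ≤ k) {E : Finset (Finset V)}
    (hF : IsForest E) (hE : ∀ f ∈ E, f.card = k) {a x : V → K} (hx0 : x ≠ 0)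
    (hne : ∀ f ∈ E, ∀ w ∈ f, x w ≠ 0) (hx : IsEigenvector E k a x) : matchingSum E a = 0 := by
  induction E using Finset.strongInduction generalizing a x with
  | H E ih =>
    rcases E.eq_empty_or_nonempty with rfl | hnonempty
    · obtain ⟨w, hw⟩ := Function.ne_iff.1 hx0
      have h1 := hx w
      rw [edgeSum_eq_zero_of_forall_notMem fun f hf => absurd hf (Finset.notMem_empty f)] at h1
      rw [matchingSum_empty]
      exact Finset.prod_eq_zero (Finset.mem_univ w)
        ((mul_eq_zero.1 h1.symm).resolve_right (pow_ne_zero _ hw))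
    · obtain ⟨e, v, h⟩ := hF E subset_rfl hnonempty
      have hss : E.erase e ⊂ E := Finset.erase_ssubset h.mem
      obtain ⟨ha, hx'⟩ := h.isEigenvector_reduce hk (hE e h.mem) hx (hne e h.mem)
      rw [h.matchingSum_reduce ha, ih _ hss (hF.mono hss.1) (fun f hf => hE f (hss.1 hf)) ?_ ?_ hx',
        mul_zero]
      · exact Function.ne_iff.2 ⟨v, by simpa using hne e h.mem v h.vertex_mem⟩
      · intro f hf w hw
        rw [if_neg fun hwe => h.notMem_of_mem_erase hwe hf hw]
        exact hne f (hss.1 hf) w hw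

/-- A positive eigenvector bounds all eigenvalues: compare at a vertex maximising
`|y_i| / x_i`. -/
theorem norm_le_of_pos_eigenvector {E : Finset (Finset V)} (hE : ∀ f ∈ E, f.card = k)
    {l : ℝ} {x : V → ℝ} (hpos : ∀ v, 0 < x v) (hx : IsEigenvector E k (fun _ => l) x)
    {z : ℂ} {y : V → ℂ} (hy0 : y ≠ 0) (hy : IsEigenvector E k (fun _ => z) y) : ‖z‖ ≤ l := by
  obtain ⟨j, hj⟩ := Function.ne_iff.1 hy0
  obtain ⟨i, -, hi⟩ := Finset.exists_max_image Finset.univ (fun w => ‖y w‖ / x w)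
    ⟨j, Finset.mem_univ j⟩
  set t := ‖y i‖ / x i with ht
  have htpos : 0 < t :=
    (div_pos (norm_pos_iff.2 hj) (hpos j)).trans_le (hi j (Finset.mem_univ j))
  have hle : ∀ w, ‖y w‖ ≤ t * x w := fun w =>
    (div_le_iff₀ (hpos w)).1 (hi w (Finset.mem_univ w))
  have heq : ‖y i‖ = t * x i := by rw [ht, div_mul_cancel₀ _ (hpos i).ne']
  have h1 : ‖z‖ * (t * x i) ^ (k - 1) ≤ l * (t * x i) ^ (k - 1) := by
    calc ‖z‖ * (t * x i) ^ (k - 1) = ‖edgeSum E y i‖ := by rw [hy i, norm_mul, norm_pow, heq]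
      _ ≤ ∑ f ∈ E with i ∈ f, ‖∏ w ∈ f.erase i, y w‖ := norm_sum_le _ _
      _ ≤ ∑ f ∈ E with i ∈ f, t ^ (k - 1) * ∏ w ∈ f.erase i, x w := by
          refine Finset.sum_le_sum fun f hf => ?_
          rw [Finset.mem_filter] at hf
          rw [norm_prod]
          refine (Finset.prod_le_prod (fun w _ => norm_nonneg _) fun w _ => hle w).trans_eq ?_
          rw [Finset.prod_mul_distrib, Finset.prod_const, Finset.card_erase_of_mem hf.2,
            hE f hf.1]
      _ = t ^ (k - 1) * edgeSum E x i := by rw [edgeSum, Finset.mul_sum]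
      _ = l * (t * x i) ^ (k - 1) := by rw [hx i, mul_pow]; ring
  exact le_of_mul_le_mul_right h1 (pow_pos (mul_pos htpos (hpos i)) _)

end

/-! ### Positive eigenvectors on trees -/

/-- The last zero of a continuous function that is eventually positive. -/
lemma exists_last_zero {g : ℝ → ℝ} {c z₀ : ℝ} (hg : ContinuousOn g (Set.Ioi c)) (hz₀ : c < z₀)
    (h₀ : g z₀ ≤ 0) (hpos : ∀ᶠ z in Filter.atTop, 0 < g z) :
    ∃ z, c < z ∧ g z = 0 ∧ ∀ z' > z, 0 < g z' := by
  obtain ⟨z₁, hz₁⟩ := Filter.eventually_atTop.1 hpos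
  have hlt : z₀ < z₁ := by
    by_contra! h
    exact absurd (hz₁ z₀ h) h₀.not_gt
  have hIcc : ContinuousOn g (Set.Icc z₀ z₁) := hg.mono fun z hz => hz₀.trans_le hz.1
  have hclosed : IsClosed (Set.Icc z₀ z₁ ∩ g ⁻¹' Set.Iic 0) :=
    hIcc.preimage_isClosed_of_isClosed isClosed_Icc isClosed_Iic
  obtain ⟨m, ⟨hm, hm0⟩, hmax⟩ := (isCompact_Icc.of_isClosed_subset hclosed
    Set.inter_subset_left).exists_isGreatest ⟨z₀, ⟨le_rfl, hlt.le⟩, h₀⟩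
  have hafter : ∀ z' > m, 0 < g z' := by
    intro z' hz'
    by_contra! hle
    rcases le_total z' z₁ with h | h
    · exact (hmax ⟨⟨hm.1.trans hz'.le, h⟩, hle⟩).not_gt hz'
    · exact (hz₁ z' h).not_ge hle
  -- a negative value at `m` would force a zero beyond `m`
  refine ⟨m, hz₀.trans_le hm.1, le_antisymm hm0 ?_, hafter⟩
  obtain ⟨r, hr, hr0⟩ := intermediate_value_Icc hm.2 (hIcc.mono (Set.Icc_subset_Icc_left hm.1))
    ⟨hm0, (hz₁ z₁ le_rfl).le⟩
  rcases hr.1.eq_or_lt with h | h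
  · rw [h, hr0]
  · exact absurd hr0 (hafter r h).ne'

/-- Beyond a suitable `c'` all the weights `a u`, `u ∈ U`, are positive; if `c` itself does not
work, `c'` is the last zero of one of them, so that `b z * ∏ a u z` is small just beyond `c'`. -/
lemma exists_threshold {V : Type*} {U : Finset V} {a : V → ℝ → ℝ} {c : ℝ}
    (hcont : ∀ u ∈ U, ContinuousOn (a u) (Set.Ioi c))
    (htop : ∀ u ∈ U, Filter.Tendsto (a u) Filter.atTop Filter.atTop) :
    (∀ z > c, ∀ u ∈ U, 0 < a u z) ∨
      ∃ c' > c, (∀ z > c', ∀ u ∈ U, 0 < a u z) ∧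
        ∀ b : ℝ → ℝ, ContinuousOn b (Set.Ioi c) → ∃ z > c', b z * ∏ u ∈ U, a u z < 1 := by
  by_cases hall : ∀ z > c, ∀ u ∈ U, 0 < a u z
  · exact Or.inl hall
  right
  push Not at hall
  obtain ⟨z₀, hz₀, u₀, hu₀, h₀⟩ := hall
  have hne : U.Nonempty := ⟨u₀, hu₀⟩
  have hg : ContinuousOn (fun z => U.inf' hne fun u => a u z) (Set.Ioi c) :=
    ContinuousOn.finset_inf'_apply hne hcont
  have hpos : ∀ᶠ z in Filter.atTop, 0 < U.inf' hne fun u => a u z := by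
    filter_upwards [(Filter.eventually_all_finset U).2 fun u hu =>
      (htop u hu).eventually_gt_atTop 0] with z hz
    exact (Finset.lt_inf'_iff hne).2 hz
  obtain ⟨c', hc', hzero, hafter⟩ := exists_last_zero hg hz₀
    ((Finset.inf'_le (fun u => a u z₀) hu₀).trans h₀) hpos
  refine ⟨c', hc', fun z hz u hu => (Finset.lt_inf'_iff hne).1 (hafter z hz) u hu,
    fun b hb => ?_⟩
  obtain ⟨u₁, hu₁, hu₁'⟩ := Finset.exists_mem_eq_inf' hne fun u => a u c'
  have hau : a u₁ c' = 0 := by rw [← hu₁', hzero]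
  have hcontp : ContinuousAt (fun z => b z * ∏ u ∈ U, a u z) c' :=
    (hb.mul (continuousOn_finsetProd U hcont)).continuousAt (Ioi_mem_nhds hc')
  have hlt : b c' * ∏ u ∈ U, a u c' < 1 := by
    rw [Finset.prod_eq_zero hu₁ hau, mul_zero]
    exact one_pos
  have hev : ∀ᶠ z in nhdsWithin c' (Set.Ioi c'), b z * ∏ u ∈ U, a u z < 1 :=
    nhdsWithin_le_nhds (hcontp.eventually_lt continuousAt_const hlt)
  obtain ⟨z, hz, hz'⟩ := (hev.and self_mem_nhdsWithin).exists
  exact ⟨z, hz', hz⟩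

section

variable {V : Type*} [DecidableEq V]

/-- The values of a positive eigenvector on a pendant edge, given the value `c > 0` at the point
of attachment. -/
lemma exists_pos_extension {k : ℕ} (hk : 2 ≤ k) {U : Finset V} (hU : U.card = k - 1)
    {a : V → ℝ} {c : ℝ} (hc : 0 < c) (ha : ∀ u ∈ U, 0 < a u) :
    ∃ y : V → ℝ, (∀ u ∈ U, 0 < y u) ∧
      (∀ u ∈ U, c * ∏ w ∈ U.erase u, y w = a u * y u ^ (k - 1)) ∧
      ∏ u ∈ U, y u = c ^ (k - 1) * ∏ u ∈ U, (a u)⁻¹ := by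
  have hk0 : k ≠ 0 := by omega
  set P := ∏ u ∈ U, (a u)⁻¹ with hP
  have hP0 : 0 < P := Finset.prod_pos fun w hw => inv_pos.2 (ha w hw)
  have ht : ∀ u ∈ U, 0 < c ^ k * P * (a u)⁻¹ := fun u hu =>
    mul_pos (mul_pos (pow_pos hc k) hP0) (inv_pos.2 (ha u hu))
  set y : V → ℝ := fun u => (c ^ k * P * (a u)⁻¹) ^ ((k : ℝ)⁻¹) with hy
  have hypos : ∀ u ∈ U, 0 < y u := fun u hu => Real.rpow_pos_of_pos (ht u hu) _
  have hyk : ∀ u ∈ U, y u ^ k = c ^ k * P * (a u)⁻¹ := fun u hu =>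
    Real.rpow_inv_natCast_pow (ht u hu).le hk0
  have hp : ∏ u ∈ U, y u = c ^ (k - 1) * P :=
    (pow_left_inj₀ (Finset.prod_pos hypos).le (mul_pos (pow_pos hc _) hP0).le hk0).1
      (prod_pow_eq_of_pow_eq (by omega) hU hyk)
  refine ⟨y, hypos, fun u hu => mul_prod_erase_eq_of_pow_eq (by omega) hc.ne'
    (fun w hw => (ha w hw).ne') (fun w hw => ?_) hp hu, hp⟩
  have := (ha w hw).ne'
  rw [hyk w hw, ← hP]
  field_simp

/-- Every proper nonempty set of vertices `S ⊆ W` is left by some edge. -/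
def IsCutConnected (E : Finset (Finset V)) (W : Finset V) : Prop :=
  ∀ S ⊆ W, S.Nonempty → S ≠ W → ∃ f ∈ E, (∃ p ∈ f, p ∈ S) ∧ ∃ q ∈ f, q ∉ S

lemma IsPendant.isCutConnected_erase {E : Finset (Finset V)} {W e : Finset V} {v : V}
    (h : IsPendant E e v) (heW : e ⊆ W) (hcut : IsCutConnected E W) :
    IsCutConnected (E.erase e) (W \ e.erase v) := by
  intro S hS hne hSW
  by_cases hv : v ∈ S
  · have hSU : S ∪ e.erase v ≠ W := by
      rintro rfl
      refine hSW ?_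
      rw [Finset.union_sdiff_right, Finset.sdiff_eq_self_iff_disjoint.2]
      exact Finset.disjoint_left.2 fun w hw => (Finset.mem_sdiff.1 (hS hw)).2
    obtain ⟨f, hf, ⟨p, hpf, hp⟩, q, hqf, hq⟩ := hcut (S ∪ e.erase v)
      (Finset.union_subset (hS.trans Finset.sdiff_subset) ((Finset.erase_subset _ _).trans heW))
      (hne.mono Finset.subset_union_left) hSU
    rw [Finset.mem_union, not_or] at hq
    have hfe : f ∈ E.erase e := by
      refine Finset.mem_erase.2 ⟨?_, hf⟩
      rintro rfl
      exact hq.2 (Finset.mem_erase.2 ⟨fun hqv => hq.1 (hqv ▸ hv), hqf⟩)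
    refine ⟨f, hfe, ⟨p, hpf, ?_⟩, q, hqf, hq.1⟩
    exact (Finset.mem_union.1 hp).resolve_right fun hpe => h.notMem_of_mem_erase hpe hfe hpf
  · obtain ⟨f, hf, ⟨p, hpf, hp⟩, q, hqf, hq⟩ := hcut S (hS.trans Finset.sdiff_subset) hne
      fun heq => hv (heq ▸ heW h.vertex_mem)
    refine ⟨f, Finset.mem_erase.2 ⟨?_, hf⟩, ⟨p, hpf, hp⟩, q, hqf, hq⟩
    rintro rfl
    exact (Finset.mem_sdiff.1 (hS hp)).2 (Finset.mem_erase.2 ⟨fun hpv => hv (hpv ▸ hp), hpf⟩)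

/-- Existence of a positive eigenvector on a tree. The weights are functions of a parameter `z`;
removing a pendant edge turns them into functions of the same kind, on a possibly smaller range
of parameters, and the intermediate value theorem settles the case of a single vertex. -/
theorem IsForest.exists_pos_eigenvector {k : ℕ} (hk : 2 ≤ k) {E : Finset (Finset V)}
    {W : Finset V} (hF : IsForest E) (hE : ∀ f ∈ E, f.card = k) (hsub : ∀ f ∈ E, f ⊆ W)
    (hcut : IsCutConnected E W) {a : V → ℝ → ℝ} {c : ℝ}
    (hcont : ∀ w ∈ W, ContinuousOn (a w) (Set.Ioi c))
    (htop : ∀ w ∈ W, Filter.Tendsto (a w) Filter.atTop Filter.atTop)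
    (hnonpos : ∃ w ∈ W, ∃ z > c, a w z ≤ 0) :
    ∃ (z : ℝ) (x : V → ℝ), c < z ∧ (∀ w ∈ W, 0 < x w) ∧ (∀ w ∉ W, x w = 0) ∧
      IsEigenvector E k (fun w => a w z) x := by
  induction E using Finset.strongInduction generalizing W a c with
  | H E ih =>
    rcases E.eq_empty_or_nonempty with rfl | hne
    · obtain ⟨w, hw, z₀, hz₀, h₀⟩ := hnonpos
      have hWw : {w} = W := by
        by_contra hne
        obtain ⟨f, hf, -⟩ := hcut {w} (Finset.singleton_subset_iff.2 hw)
          (Finset.singleton_nonempty w) hne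
        exact Finset.notMem_empty f hf
      subst hWw
      obtain ⟨z, hz, hz0, -⟩ := exists_last_zero (hcont w hw) hz₀ h₀
        ((htop w hw).eventually_gt_atTop 0)
      refine ⟨z, Pi.single w 1, hz, fun u hu => ?_, fun u hu => ?_, fun u => ?_⟩
      · rw [Finset.mem_singleton.1 hu, Pi.single_eq_same]
        exact one_pos
      · exact Pi.single_eq_of_ne (fun huw => hu (Finset.mem_singleton.2 huw)) 1
      · rw [edgeSum_eq_zero_of_forall_notMem fun f hf => absurd hf (Finset.notMem_empty f)]
        by_cases huw : u = w
        · simp only [huw, hz0, zero_mul]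
        · rw [Pi.single_eq_of_ne huw, zero_pow (by omega), mul_zero]
    · obtain ⟨e, v, h⟩ := hF E subset_rfl hne
      have hss : E.erase e ⊂ E := Finset.erase_ssubset h.mem
      have heW := hsub e h.mem
      have hvW := heW h.vertex_mem
      have hUW : e.erase v ⊆ W := (Finset.erase_subset _ _).trans heW
      have hU : (e.erase v).card = k - 1 := by
        rw [Finset.card_erase_of_mem h.vertex_mem, hE e h.mem]
      have hvW' : v ∈ W \ e.erase v := Finset.mem_sdiff.2 ⟨hvW, Finset.notMem_erase v e⟩
      have hred : ∀ w ∈ W \ e.erase v, w ≠ v → ∀ z, reduceWeight (fun w => a w z) e v w = a w z := by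
        intro w hw hwv z
        rw [reduceWeight, if_neg hwv, if_neg]
        exact fun hwe => (Finset.mem_sdiff.1 hw).2 (Finset.mem_erase.2 ⟨hwv, hwe⟩)
      have hredv : ∀ z, reduceWeight (fun w => a w z) e v v
          = a v z - ∏ u ∈ e.erase v, (a u z)⁻¹ := fun z => if_pos rfl
      -- the hypothesis on nonpositive weights survives the reduction: either the old witness still
      -- works, or the weight at `v` becomes negative just beyond the last zero of the `a u`
      obtain ⟨c', hcc', hpos, hnonpos'⟩ : ∃ c' ≥ c, (∀ z > c', ∀ u ∈ e.erase v, 0 < a u z) ∧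
          ∃ w ∈ W \ e.erase v, ∃ z > c', reduceWeight (fun w => a w z) e v w ≤ 0 := by
        rcases exists_threshold (fun u hu => hcont u (hUW hu)) fun u hu => htop u (hUW hu) with
          hpos | ⟨c', hc', hpos, hsmall⟩
        · obtain ⟨w, hw, z, hz, hwz⟩ := hnonpos
          have hw' : w ∈ W \ e.erase v :=
            Finset.mem_sdiff.2 ⟨hw, fun hwU => (hpos z hz w hwU).not_ge hwz⟩
          refine ⟨c, le_rfl, hpos, w, hw', z, hz, ?_⟩
          by_cases hwv : w = v
          · rw [hwv, hredv, ← hwv]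
            have := (Finset.prod_pos fun u hu => inv_pos.2 (hpos z hz u hu)).le
            rw [← hwv] at this
            linarith
          · rwa [hred w hw' hwv]
        · obtain ⟨z, hz, hlt⟩ := hsmall (a v) (hcont v hvW)
          refine ⟨c', hc'.le, hpos, v, hvW', z, hz, ?_⟩
          have hp : 0 < ∏ u ∈ e.erase v, a u z := Finset.prod_pos fun u hu => hpos z hz u hu
          rw [hredv, Finset.prod_inv_distrib, sub_nonpos, ← one_div, le_div_iff₀ hp]
          exact hlt.le
      have hmono : Set.Ioi c' ⊆ Set.Ioi c := Set.Ioi_subset_Ioi hcc'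
      have hcont' : ∀ w ∈ W \ e.erase v,
          ContinuousOn (fun z => reduceWeight (fun w => a w z) e v w) (Set.Ioi c') := by
        intro w hw
        by_cases hwv : w = v
        · subst hwv
          simp only [hredv]
          exact ((hcont w hvW).mono hmono).sub (continuousOn_finsetProd _ fun u hu =>
            ((hcont u (hUW hu)).mono hmono).inv₀ fun z hz => (hpos z hz u hu).ne')
        · simp only [hred w hw hwv]
          exact (hcont w (Finset.mem_sdiff.1 hw).1).mono hmono
      have htop' : ∀ w ∈ W \ e.erase v,
          Filter.Tendsto (fun z => reduceWeight (fun w => a w z) e v w) Filter.atTop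
            Filter.atTop := by
        intro w hw
        by_cases hwv : w = v
        · subst hwv
          simp only [hredv]
          refine Filter.tendsto_atTop_mono' _ ?_
            (Filter.tendsto_atTop_add_const_right _ (-1) (htop w hvW))
          filter_upwards [(Filter.eventually_all_finset (e.erase w)).2 fun u hu =>
            (htop u (hUW hu)).eventually_ge_atTop 1] with z hz
          have : ∏ u ∈ e.erase w, (a u z)⁻¹ ≤ 1 := Finset.prod_le_one
            (fun u hu => inv_nonneg.2 (zero_le_one.trans (hz u hu)))
            fun u hu => inv_le_one_of_one_le₀ (hz u hu)
          linarith
        · simp only [hred w hw hwv]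
          exact htop w (Finset.mem_sdiff.1 hw).1
      obtain ⟨z, x, hz, hxpos, hxzero, hx⟩ := ih _ hss (hF.mono hss.1)
        (fun f hf => hE f (hss.1 hf))
        (fun f hf w hw => Finset.mem_sdiff.2 ⟨hsub f (hss.1 hf) hw,
          fun hwU => h.notMem_of_mem_erase hwU hf hw⟩)
        (h.isCutConnected_erase heW hcut) hcont' htop' hnonpos'
      obtain ⟨y, hypos, hy1, hy2⟩ := exists_pos_extension hk hU (hxpos v hvW') (hpos z hz)
      refine ⟨z, _, hcc'.trans_lt hz, fun w hw => ?_, fun w hw => ?_,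
        h.isEigenvector_extend hx hy1 hy2⟩
      · by_cases hwU : w ∈ e.erase v
        · simpa only [if_pos hwU] using hypos w hwU
        · simpa only [if_neg hwU] using hxpos w (Finset.mem_sdiff.2 ⟨hw, hwU⟩)
      · have hwU : w ∉ e.erase v := fun hwU => hw (hUW hwU)
        simpa only [if_neg hwU] using hxzero w fun hw' => hw (Finset.mem_sdiff.1 hw').1

end

/-! ### Hypergraphs with finitely many vertices -/

lemma image_val_injective {α : Type*} {T : Hypergraph α} :
    Function.Injective fun e : Finset T.vertexSet => (Subtype.val '' (e : Set T.vertexSet)) :=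
  fun _ _ h => Finset.coe_injective (Subtype.val_injective.image_injective h)

section

variable {α : Type*} (T : Hypergraph α) [Fintype T.vertexSet]

open Classical in
/-- The edges of a hypergraph on finitely many vertices, as finsets of vertices. -/
noncomputable def edgeFamily : Finset (Finset T.vertexSet) :=
  Finset.univ.filter fun e => (Subtype.val '' (e : Set T.vertexSet)) ∈ T.edgeSet

variable {T} {k : ℕ}

lemma mem_edgeFamily {e : Finset T.vertexSet} :
    e ∈ T.edgeFamily ↔ (Subtype.val '' (e : Set T.vertexSet)) ∈ T.edgeSet := by
  simp only [edgeFamily, Finset.mem_filter, Finset.mem_univ, true_and]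

/-- Every edge lies in the vertex set, so it comes from a member of `T.edgeFamily`. -/
lemma exists_finset_of_mem_edgeSet {s : Set α} (hs : s ∈ T.edgeSet) :
    ∃ e ∈ T.edgeFamily, (Subtype.val '' (e : Set T.vertexSet)) = s := by
  classical
  have h : Subtype.val '' ((Finset.univ.filter fun v : T.vertexSet => (v : α) ∈ s :
      Finset T.vertexSet) : Set T.vertexSet) = s := by
    ext w
    simp only [Finset.coe_filter, Finset.mem_univ, true_and, Set.mem_image, Set.mem_ofPred_eq]
    constructor
    · rintro ⟨v, hv, rfl⟩
      exact hv
    · exact fun hw => ⟨⟨w, T.mem_vertexSet_of_mem_edgeSet hs hw⟩, hw, rfl⟩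
  exact ⟨_, mem_edgeFamily.2 (h.symm ▸ hs), h⟩

lemma IsUniform.card_eq (hT : T.IsUniform k) {e : Finset T.vertexSet} (he : e ∈ T.edgeFamily) :
    e.card = k := by
  rw [← hT _ (mem_edgeFamily.1 he), Set.ncard_image_of_injective _ Subtype.val_injective,
    Set.ncard_coe_finset]

/-- In a family without pendant edges one can walk forever, never leaving an edge through the
vertex by which it was entered and never staying in the same edge. The first repetition of a
vertex or of an edge closes a cycle. -/
theorem IsAcyclic.isForest (hk : 2 ≤ k) (hu : T.IsUniform k) (hT : T.IsAcyclic) :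
    IsForest T.edgeFamily := by
  intro F hF ⟨e₀, he₀⟩
  by_contra hno
  have hstep : ∀ s : {p : T.vertexSet × Finset T.vertexSet // p.2 ∈ F ∧ p.1 ∈ p.2},
      ∃ t : {p : T.vertexSet × Finset T.vertexSet // p.2 ∈ F ∧ p.1 ∈ p.2},
        t.1.1 ∈ s.1.2 ∧ t.1.1 ≠ s.1.1 ∧ t.1.2 ≠ s.1.2 := by
    rintro ⟨⟨v, e⟩, he, hv⟩
    by_contra! hcon
    exact hno ⟨e, v, he, hv, fun u hu huv f hf huf => hcon ⟨(u, f), hf, huf⟩ hu huv⟩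
  choose next hnext using hstep
  obtain ⟨v₀, hv₀⟩ : e₀.Nonempty := by
    rw [← Finset.card_pos, hu.card_eq (hF he₀)]
    omega
  let s : ℕ → {p : T.vertexSet × Finset T.vertexSet // p.2 ∈ F ∧ p.1 ∈ p.2} :=
    fun n => next^[n] ⟨(v₀, e₀), he₀, hv₀⟩
  let v : ℕ → T.vertexSet := fun n => (s n).1.1
  let e : ℕ → Finset T.vertexSet := fun n => (s n).1.2
  have hs : ∀ n, s (n + 1) = next (s n) := fun n => Function.iterate_succ_apply' _ _ _
  have hvn : ∀ n, v (n + 1) ≠ v n := fun n => by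
    simpa only [v, hs] using (hnext (s n)).2.1
  have hen : ∀ n, e (n + 1) ≠ e n := fun n => by
    simpa only [e, hs] using (hnext (s n)).2.2
  have hmem : ∀ n, v n ∈ e n := fun n => (s n).2.2
  have hmem' : ∀ n, v (n + 1) ∈ e n := fun n => by
    simpa only [v, hs] using (hnext (s n)).1
  have heF : ∀ n, e n ∈ F := fun n => (s n).2.1
  have hrep : ∃ d, 1 ≤ d ∧ ∃ i, v (i + d) = v i ∨ e (i + d) = e i := by
    obtain ⟨i, j, hij, hsij⟩ := Finite.exists_ne_map_eq_of_infinite s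
    wlog hlt : i < j generalizing i j
    · exact this j i hij.symm hsij.symm (by omega)
    refine ⟨j - i, by omega, i, Or.inl ?_⟩
    rw [Nat.add_sub_cancel' hlt.le]
    exact congrArg (fun t => t.1.1) hsij.symm
  classical
  obtain ⟨hd1, i, hi⟩ := Nat.find_spec hrep
  have hmin : ∀ m n, m < n → n - m < Nat.find hrep → v m ≠ v n ∧ e m ≠ e n := by
    intro m n hmn hlt
    have h1 := Nat.find_min hrep hlt
    push Not at h1
    have h2 := h1 (by omega) m
    rw [Nat.add_sub_cancel' hmn.le] at h2
    exact ⟨h2.1.symm, h2.2.symm⟩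
  set d := Nat.find hrep with hd
  have hd2 : 2 ≤ d := by
    rcases hd1.eq_or_lt with h | h
    · rw [← h] at hi
      exact absurd hi (not_or.2 ⟨hvn i, hen i⟩)
    · exact h
  have hvinj : ∀ m n, m ≠ n → m < n + d → n < m + d → v m ≠ v n := by
    intro m n hne h1 h2
    rcases hne.lt_or_gt with h | h
    · exact (hmin m n h (by omega)).1
    · exact (hmin n m h (by omega)).1.symm
  have heinj : ∀ m n, m ≠ n → m < n + d → n < m + d → e m ≠ e n := by
    intro m n hne h1 h2
    rcases hne.lt_or_gt with h | h
    · exact (hmin m n h (by omega)).2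
    · exact (hmin n m h (by omega)).2.symm
  -- `v (i + d)` lies in `e i` whether a vertex or an edge is repeated
  have hclose : v (i + d) ∈ e i := by
    rcases hi with h | h
    · rw [h]; exact hmem i
    · rw [← h]; exact hmem (i + d)
  -- the cycle is `v (i + d), e i, v (i + 1), e (i + 1), …, e (i + d - 1), v (i + d)`
  refine hT d (fun j => ((if (j : ℕ) = 0 then v (i + d) else v (i + j) : T.vertexSet) : α))
    (fun j => Subtype.val '' (e (i + j) : Set T.vertexSet))
    ⟨hd2, fun j => ⟨?_, ?_, ?_⟩, ?_, ?_, ?_⟩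
  · exact mem_edgeFamily.1 (hF (heF _))
  · refine Set.mem_image_of_mem _ (Finset.mem_coe.2 ?_)
    split_ifs with h
    · rw [Fin.val_castSucc] at h
      rw [h]
      exact hclose
    · exact hmem _
  · refine Set.mem_image_of_mem _ (Finset.mem_coe.2 ?_)
    rw [if_neg (by simp), Fin.val_succ]
    exact hmem' _
  · have : d ≠ 0 := by omega
    simp [this]
  · intro j₁ j₂ h
    by_contra hne
    have hne' : (j₁ : ℕ) ≠ j₂ := fun h => hne (Fin.ext h)
    have l1 := j₁.2
    have l2 := j₂.2
    have h := Subtype.val_injective h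
    simp only [Fin.val_castSucc] at h
    split_ifs at h with a1 a2 a2
    · omega
    · exact hvinj _ _ (by omega) (by omega) (by omega) h
    · exact hvinj _ _ (by omega) (by omega) (by omega) h
    · exact hvinj _ _ (by omega) (by omega) (by omega) h
  · intro j₁ j₂ h
    by_contra hne
    have hne' : (j₁ : ℕ) ≠ j₂ := fun h => hne (Fin.ext h)
    have l1 := j₁.2
    have l2 := j₂.2
    exact heinj _ _ (by omega) (by omega) (by omega) (image_val_injective h)

lemma numMatchings_eq (r : ℕ) :
    T.numMatchings r = ((matchings T.edgeFamily).filter fun N => N.card = r).card := by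
  have hinj : Function.Injective fun N : Finset (Finset T.vertexSet) =>
      (fun e : Finset T.vertexSet => Subtype.val '' (e : Set T.vertexSet)) ''
        (N : Set (Finset T.vertexSet)) :=
    fun _ _ h => Finset.coe_injective (image_val_injective.image_injective h)
  rw [numMatchings, ← Set.ncard_coe_finset, ← Set.ncard_image_of_injective _ hinj]
  have hdisj : ∀ e f : Finset T.vertexSet,
      Disjoint (Subtype.val '' (e : Set T.vertexSet)) (Subtype.val '' (f : Set T.vertexSet)) ↔
        Disjoint e f := fun e f => by
    rw [Set.disjoint_image_iff Subtype.val_injective, Finset.disjoint_coe]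
  congr 1
  ext M
  simp only [Set.mem_ofPred_eq, Set.mem_image, Finset.coe_filter, mem_matchings]
  constructor
  · rintro ⟨⟨hM, hp⟩, rfl⟩
    have hex : ∃ N : Finset (Finset T.vertexSet),
        (fun e : Finset T.vertexSet => Subtype.val '' (e : Set T.vertexSet)) ''
          (N : Set (Finset T.vertexSet)) = M := by
      classical
      refine ⟨Finset.univ.filter fun e => Subtype.val '' (e : Set T.vertexSet) ∈ M, ?_⟩
      ext s
      simp only [Finset.coe_filter, Finset.mem_univ, true_and, Set.mem_image, Set.mem_ofPred_eq]
      constructor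
      · rintro ⟨e, he, rfl⟩
        exact he
      · intro hs
        obtain ⟨e, -, rfl⟩ := exists_finset_of_mem_edgeSet (hM hs)
        exact ⟨e, hs, rfl⟩
    obtain ⟨N, rfl⟩ := hex
    refine ⟨N, ⟨⟨fun e he => mem_edgeFamily.2 (hM ⟨e, he, rfl⟩), fun e he f hf hne => ?_⟩, ?_⟩, rfl⟩
    · exact (hdisj e f).1 (hp ⟨e, he, rfl⟩ ⟨f, hf, rfl⟩ (image_val_injective.ne hne))
    · rw [Set.ncard_image_of_injective _ image_val_injective, Set.ncard_coe_finset]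
  · rintro ⟨N, ⟨⟨hN, hp⟩, rfl⟩, rfl⟩
    refine ⟨⟨?_, ?_⟩, ?_⟩
    · rintro _ ⟨e, he, rfl⟩
      exact mem_edgeFamily.1 (hN he)
    · rintro _ ⟨e, he, rfl⟩ _ ⟨f, hf, rfl⟩ hne
      exact (hdisj e f).2 (hp he hf fun h => hne (h ▸ rfl))
    · rw [Set.ncard_image_of_injective _ image_val_injective, Set.ncard_coe_finset]

lemma edgeSet_ncard_eq : T.edgeSet.ncard = T.edgeFamily.card := by
  rw [← Set.ncard_coe_finset, ← Set.ncard_image_of_injective _ image_val_injective]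
  congr 1
  ext s
  constructor
  · exact fun hs => exists_finset_of_mem_edgeSet hs
  · rintro ⟨e, he, rfl⟩
    exact mem_edgeFamily.1 he

variable [DecidableEq T.vertexSet]

/-- A path from inside `S` to outside `S` uses an edge that leaves `S`. -/
lemma IsConnected.isCutConnected (hT : T.IsConnected) :
    IsCutConnected T.edgeFamily Finset.univ := by
  intro S _ ⟨p, hp⟩ hne
  obtain ⟨q, hq⟩ : ∃ q, q ∉ S := by
    by_contra! h
    exact hne (Finset.eq_univ_iff_forall.2 h)
  obtain ⟨l, v, e, ⟨hwalk, -⟩, h0, hl⟩ := hT.2 p p.2 q q.2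
  by_contra! hcon
  have hall : ∀ j : Fin (l + 1), ∃ w ∈ S, (w : α) = v j := by
    intro j
    induction j using Fin.induction with
    | zero => exact ⟨p, hp, h0.symm⟩
    | succ j ih =>
      obtain ⟨w, hw, hwj⟩ := ih
      obtain ⟨he, h1, h2⟩ := hwalk j
      obtain ⟨f, hf, hfe⟩ := exists_finset_of_mem_edgeSet he
      rw [← hfe] at h1 h2
      obtain ⟨w', hw', hwj'⟩ := h1
      obtain ⟨u, hu, huj⟩ := h2
      have : w' = w := Subtype.val_injective (hwj'.trans hwj.symm)
      subst this
      exact ⟨u, hcon f hf ⟨w', hw', hw⟩ u hu, huj⟩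
  obtain ⟨w, hw, hwl⟩ := hall (Fin.last l)
  exact hq (Subtype.val_injective (hwl.trans hl) ▸ hw)

lemma matchingTerm_const {V R : Type*} [DecidableEq V] [Fintype V] [CommRing R]
    {E N : Finset (Finset V)} (hE : ∀ e ∈ E, e.card = k) (hN : N ∈ matchings E) (z : R) :
    matchingTerm (fun _ => z) N = (-1) ^ N.card * z ^ (Fintype.card V - k * N.card) := by
  rw [mem_matchings] at hN
  rw [matchingTerm, Finset.prod_ite, Finset.prod_const_one, one_mul, Finset.prod_const]
  congr 2
  have h1 : (Finset.univ.filter fun w => ¬ ∃ f ∈ N, w ∈ f) = (N.biUnion id)ᶜ := by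
    ext w
    simp
  have h2 : ∀ f ∈ N, (id f).card = k := fun f hf => hE f (hN.1 hf)
  rw [h1, Finset.card_compl, Finset.card_biUnion hN.2, Finset.sum_congr rfl h2, Finset.sum_const,
    smul_eq_mul, mul_comm]

/-- The matching polynomial is the multivariate one with all variables equal. -/
lemma IsUniform.aeval_matchingPoly {K : Type*} [Field K] [Algebra ℝ K] (hT : T.IsUniform k)
    (z : K) :
    Polynomial.aeval z (T.matchingPoly k) = matchingSum T.edgeFamily fun _ => z := by
  have hE : ∀ e ∈ T.edgeFamily, e.card = k := fun e he => hT.card_eq he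
  rw [matchingSum, ← Finset.sum_fiberwise_of_maps_to
    (t := Finset.range (T.edgeFamily.card + 1)) (g := Finset.card)
    (fun N hN => Finset.mem_range_succ_iff.2 (Finset.card_le_card (mem_matchings.1 hN).1)),
    matchingPoly, map_sum, edgeSet_ncard_eq]
  refine Finset.sum_congr rfl fun r _ => ?_
  have h1 : ∀ N ∈ (matchings T.edgeFamily).filter (fun N => N.card = r),
      matchingTerm (fun _ => z) N = (-1) ^ r * z ^ (T.vertexSet.ncard - k * r) := by
    intro N hN
    rw [Finset.mem_filter] at hN
    rw [matchingTerm_const hE hN.1, hN.2, ← Nat.card_coe_set_eq, Nat.card_eq_fintype_card]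
  rw [Finset.sum_congr rfl h1, Finset.sum_const, ← numMatchings_eq, nsmul_eq_mul]
  simp only [map_mul, map_pow, map_neg, map_one, map_natCast,
    Polynomial.aeval_X]
  ring

/-- Each edge `e` containing `i` accounts for `(k - 1)!` nonzero entries in the slice at `i` of the
adjacency tensor, one for each ordering of the other vertices of `e`. -/
lemma IsUniform.adjacencyTensor_apply (hk : 1 ≤ k) (hT : T.IsUniform k) (x : T.vertexSet → ℂ) :
    (T.adjacencyTensor k).apply x = edgeSum T.edgeFamily x := by
  funext i
  have hiff : ∀ j : Fin (k - 1) → T.vertexSet,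
      insert (i : α) (Set.range fun l => (j l : α)) ∈ T.edgeSet ↔
        insert i (Finset.univ.image j) ∈ T.edgeFamily := by
    intro j
    rw [mem_edgeFamily, Finset.coe_insert, Set.image_insert_eq, Finset.coe_image, Finset.coe_univ,
      Set.image_univ, ← Set.range_comp]
    rfl
  have h1 : (T.adjacencyTensor k).apply x i = ∑ j : Fin (k - 1) → T.vertexSet,
      if insert i (Finset.univ.image j) ∈ T.edgeFamily then
        ((k - 1).factorial : ℂ)⁻¹ * ∏ l, x (j l) else 0 := by
    refine Finset.sum_congr rfl fun j _ => ?_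
    rw [adjacencyTensor]
    by_cases h : insert i (Finset.univ.image j) ∈ T.edgeFamily
    · rw [if_pos ((hiff j).2 h), if_pos h]
      push_cast
      rw [one_div]
    · rw [if_neg (fun h' => h ((hiff j).1 h')), if_neg h, Complex.ofReal_zero, zero_mul]
  rw [h1, ← Finset.sum_filter, edgeSum, ← Finset.sum_fiberwise_of_maps_to
    (t := T.edgeFamily.filter fun e => i ∈ e) (g := fun j => insert i (Finset.univ.image j))
    (fun j hj => Finset.mem_filter.2
      ⟨(Finset.mem_filter.1 hj).2, Finset.mem_insert_self _ _⟩)]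
  refine Finset.sum_congr rfl fun e he => ?_
  rw [Finset.mem_filter] at he
  have hcard : (e.erase i).card = k - 1 := by
    rw [Finset.card_erase_of_mem he.2, hT.card_eq he.1]
  -- `e` has `k` elements, so `i` together with the `k - 1` values of `j` exhausts `e` only if `j`
  -- enumerates `e.erase i` without repetition
  have hset : ((Finset.univ.filter fun j : Fin (k - 1) → T.vertexSet =>
      insert i (Finset.univ.image j) ∈ T.edgeFamily).filter fun j =>
        insert i (Finset.univ.image j) = e) =
      Finset.univ.image fun (σ : Fin (k - 1) ≃ e.erase i) l => (σ l : T.vertexSet) := by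
    ext j
    simp only [Finset.mem_filter, Finset.mem_univ, true_and, Finset.mem_image]
    constructor
    · rintro ⟨-, hj⟩
      have hle : (Finset.univ.image j).card ≤ k - 1 := by
        simpa using Finset.card_image_le (s := Finset.univ) (f := j)
      have hi : i ∉ Finset.univ.image j := by
        intro hi
        have h2 := hT.card_eq he.1
        rw [Finset.insert_eq_of_mem hi] at hj
        rw [hj] at hle
        omega
      have himg : Finset.univ.image j = e.erase i := by
        rw [← hj, Finset.erase_insert hi]
      have hinj : Function.Injective j := by
        rw [← Set.injOn_univ, ← Finset.coe_univ, ← Finset.card_image_iff, himg, hcard,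
          Finset.card_univ, Fintype.card_fin]
      have hmem : ∀ l, j l ∈ e.erase i := fun l => by
        rw [← himg]
        exact Finset.mem_image_of_mem j (Finset.mem_univ l)
      refine ⟨Equiv.ofBijective (fun l => (⟨j l, hmem l⟩ : e.erase i)) ⟨?_, ?_⟩, rfl⟩
      · exact fun l₁ l₂ h => hinj (congrArg Subtype.val h)
      · rintro ⟨w, hw⟩
        rw [← himg] at hw
        obtain ⟨l, -, hl⟩ := Finset.mem_image.1 hw
        exact ⟨l, Subtype.ext hl⟩
    · rintro ⟨σ, rfl⟩
      have himg : (Finset.univ.image fun l => (σ l : T.vertexSet)) = e.erase i := by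
        ext w
        simp only [Finset.mem_image, Finset.mem_univ, true_and]
        constructor
        · rintro ⟨l, rfl⟩
          exact (σ l).2
        · exact fun hw => ⟨σ.symm ⟨w, hw⟩, by rw [Equiv.apply_symm_apply]⟩
      rw [himg, Finset.insert_erase he.2]
      exact ⟨he.1, rfl⟩
  rw [hset, Finset.sum_image fun σ _ τ _ h =>
    Equiv.ext fun l => Subtype.ext (congrFun h l)]
  have hprod : ∀ σ : Fin (k - 1) ≃ e.erase i, ∏ l, x (σ l) = ∏ w ∈ e.erase i, x w := fun σ => by
    rw [← Finset.prod_coe_sort (e.erase i) x]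
    exact Equiv.prod_comp σ fun w : e.erase i => x w
  have hequiv : Fintype.card (Fin (k - 1) ≃ e.erase i) = (k - 1).factorial := by
    have h2 : Fintype.card (Fin (k - 1)) = Fintype.card (e.erase i) := by
      rw [Fintype.card_fin, Fintype.card_coe, hcard]
    rw [Fintype.card_equiv (Fintype.equivOfCardEq h2), Fintype.card_fin]
  rw [Finset.sum_congr rfl fun σ _ => by rw [hprod σ], Finset.sum_const, Finset.card_univ, hequiv,
    nsmul_eq_mul, ← mul_assoc, mul_inv_cancel₀ (Nat.cast_ne_zero.2 (Nat.factorial_ne_zero _)),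
    one_mul]

lemma IsUniform.isEigenvalue_iff (hk : 1 ≤ k) (hT : T.IsUniform k) (z : ℂ) :
    (T.adjacencyTensor k).IsEigenvalue z ↔
      ∃ x : T.vertexSet → ℂ, x ≠ 0 ∧ IsEigenvector T.edgeFamily k (fun _ => z) x := by
  simp only [RealTensor.IsEigenvalue, IsEigenvector, hT.adjacencyTensor_apply hk]

end

end Hypergraph

/-- For a finite `k`-tree `T` (`k ≥ 2`): every zero of the matching polynomial is an eigenvalue of
the adjacency tensor; the largest modulus `λ(T)` of a zero of the matching polynomial exists and is
itself a root; the largest modulus of an eigenvalue exists; and the two are equal. -/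
theorem theorem1p3 {α : Type*} (T : Hypergraph α) [Fintype T.vertexSet] (k : ℕ) (hk : 2 ≤ k)
    (hT : T.IsKTree k) :
    (∀ z : ℂ, Polynomial.aeval z (T.matchingPoly k) = 0 →
      (T.adjacencyTensor k).IsEigenvalue z) ∧
    IsGreatest (T.zeroModuli k) (T.maxZeroModulus k) ∧
    (T.matchingPoly k).IsRoot (T.maxZeroModulus k) ∧
    IsGreatest (T.adjacencyTensor k).eigenvalueModuli (T.adjacencyTensor k).spectralRadius ∧
    T.maxZeroModulus k = (T.adjacencyTensor k).spectralRadius := by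
  classical
  have hk1 : 1 ≤ k := one_le_two.trans hk
  have hE : ∀ e ∈ T.edgeFamily, e.card = k := fun e he => hT.uniform.card_eq he
  have hF : Hypergraph.IsForest T.edgeFamily := hT.acyclic.isForest hk hT.uniform
  have hzero : ∀ z : ℂ, Polynomial.aeval z (T.matchingPoly k) = 0 →
      (T.adjacencyTensor k).IsEigenvalue z := by
    intro z hz
    rw [hT.uniform.aeval_matchingPoly] at hz
    exact (hT.uniform.isEigenvalue_iff hk1 z).2 (hF.exists_isEigenvector hk hE hz)
  obtain ⟨v, hv⟩ := hT.connected.1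
  -- all weights equal to the parameter `z`; they vanish at `0`, which lies beyond `-1`
  obtain ⟨l, x, -, hpos, -, hx⟩ := hF.exists_pos_eigenvector hk hE
    (fun f _ => Finset.subset_univ f) hT.connected.isCutConnected (a := fun _ z => z) (c := -1)
    (fun _ _ => continuousOn_id) (fun _ _ => Filter.tendsto_id)
    ⟨⟨v, hv⟩, Finset.mem_univ _, 0, by norm_num, le_rfl⟩
  have hpos' : ∀ w, 0 < x w := fun w => hpos w (Finset.mem_univ w)
  -- `l` is a zero of modulus `l`, and no eigenvalue has larger modulus
  have hroot : Polynomial.aeval l (T.matchingPoly k) = 0 := by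
    rw [hT.uniform.aeval_matchingPoly]
    exact hF.matchingSum_eq_zero hk1 hE (Function.ne_iff.2 ⟨⟨v, hv⟩, (hpos' _).ne'⟩)
      (fun _ _ w _ => (hpos' w).ne') hx
  have hrootC : Polynomial.aeval (l : ℂ) (T.matchingPoly k) = 0 := by
    have := Polynomial.aeval_algebraMap_apply ℂ l (T.matchingPoly k)
    rwa [hroot, map_zero] at this
  have hbound : ∀ z : ℂ, (T.adjacencyTensor k).IsEigenvalue z → ‖z‖ ≤ l := by
    intro z hz
    obtain ⟨y, hy0, hy⟩ := (hT.uniform.isEigenvalue_iff hk1 z).1 hz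
    exact Hypergraph.norm_le_of_pos_eigenvector hE hpos' hx hy0 hy
  have hnorm : ‖(l : ℂ)‖ = l := by
    rw [Complex.norm_real]
    exact Real.norm_of_nonneg ((norm_nonneg _).trans (hbound l (hzero l hrootC)))
  have hg1 : IsGreatest (T.zeroModuli k) l := by
    refine ⟨⟨l, hrootC, hnorm⟩, ?_⟩
    rintro _ ⟨z, hz, rfl⟩
    exact hbound z (hzero z hz)
  have hg2 : IsGreatest (T.adjacencyTensor k).eigenvalueModuli l := by
    refine ⟨⟨l, hzero l hrootC, hnorm⟩, ?_⟩
    rintro _ ⟨z, hz, rfl⟩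
    exact hbound z hz
  have h1 : T.maxZeroModulus k = l := hg1.csSup_eq
  have h2 : (T.adjacencyTensor k).spectralRadius = l := hg2.csSup_eq
  rw [h1, h2]
  exact ⟨hzero, hg1, by rwa [Polynomial.coe_aeval_eq_eval] at hroot, hg2, rfl⟩
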